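/- Let $(\Omega,\Sigma,\mu)$ be a $\sigma$-finite measure space in which every atom is (up to a null set) a singleton of measure $1$; let $\Omega_a$ be the set of atoms and $\Omega_{na}=\Omega\setminus\Omega_a$. Let $\Phi:\mathbb R\to[0,\infty)$ be an Orlicz function (nonzero, convex, even, $\Phi(0)=0$), $a(\Phi)=\sup\{u\ge 0:\Phi(u)=0\}$, $I_\Phi(x)=\int_\Omega\Phi(x(t))\,d\mu\in[0,\infty]$. Let $L^\Phi(\mu)$ (resp. $E^\Phi(\mu)$) be the space of ($\mu$-a.e. classes of) measurable functions $x:\Omega\to\mathbb R$ with $I_\Phi(\lambda x)<\infty$ for some (resp. all) $\lambda>0$, ordered $\mu$-a.e. pointwise. Let $p$ be a lattice norm on $\mathbb R^2$ (i.e. $|u|\le|u'|,\ |v|\le|v'|$ imply $p((u,v))\le p((u',v'))$) with $p((1,0))=p((0,1))=1$ that is strictly monotone: $0\le w\le w'$ coordinatewise and $w\ne w'$ imply $p(w)<p(w')$. Put $$\|x\|_{\Phi,p}=\inf_{k>0}\tfrac1k\,p\big((1,I_\Phi(kx))\big),\qquad K(x)=\Big\{k\in(0,\infty):\|x\|_{\Phi,p}=\tfrac1k\,p\big((1,I_\Phi(kx))\big)\Big\},$$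 where $p((1,\infty))=\infty$. The suitable $\Delta_2$-condition for $\Phi$ and $\mu$ is the conjunction of the following requirements, where the inequality $\Phi(2u)\le C\,\Phi(u)$ is meant with some constant $C>0$: if $\mu(\Omega_{na})=\infty$, the inequality holds for all $u\ge0$; if $0<\mu(\Omega_{na})<\infty$, it holds for all $u\ge u_0$ with some $u_0>0$; if $\Omega_a$ is infinite, it holds for all $0\le u\le u_0$ with some $u_0>0$. A normed lattice $X$ is uniformly monotone if for each $\varepsilon\in(0,1)$ there is $\delta\in(0,1)$ such that $0\le x\le y$, $\|x\|\ge\varepsilon$, $\|y\|=1$ imply $\|y-x\|\le1-\delta$. It is upper locally uniformly monotone if for each $y\ge0$ with $\|y\|=1$ and each $\varepsilon>0$ there is $\sigma>0$ such that $x\ge0$, $\|x\|\ge\varepsilon$ imply $\|y+x\|\ge1+\sigma$. Consider the conditions: (i) $a(\Phi)=0$ and $\Phi$ satisfies the suitable $\Delta_2$-condition; (ii) $(L^\Phi(\mu),\|\cdot\|_{\Phi,p})$ is uniformly monotone; (iii) $(L^\Phi(\mu),\|\cdot\|_{\Phi,p})$ is upper locally uniformly monotone; (iv) $(E^\Phi(\mu),\|\cdot\|_{\Phi,p})$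 is upper locally uniformly monotone. Then (i)$\Rightarrow$(ii)$\Rightarrow$(iii)$\Rightarrow$(iv). If moreover $K(x)\neq\emptyset$ for every $x\in E^\Phi(\mu)\setminus\{0\}$, and there is $A\in\Sigma$ with $\mu(A)>0$ and $\mu(\Omega\setminus A)>0$, then (iv)$\Rightarrow$(i), so that all four conditions are equivalent. -/

import Mathlib

open MeasureTheory Set
open scoped ENNReal

noncomputable section

namespace OrliczLattice

/-- An Orlicz function: a nonzero, convex, even function `ℝ → [0, ∞)` vanishing at zero. -/
structure OrliczFunction where
  toFun : ℝ → ℝ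
  nonneg : ∀ u, 0 ≤ toFun u
  map_zero : toFun 0 = 0
  even : ∀ u, toFun (-u) = toFun u
  convex : ConvexOn ℝ univ toFun
  ne_zero : ∃ u, toFun u ≠ 0

instance : CoeFun OrliczFunction (fun _ => ℝ → ℝ) := ⟨OrliczFunction.toFun⟩

/-- `a(Φ) = sup {u ≥ 0 : Φ(u) = 0}`. -/
def OrliczFunction.a (Φ : OrliczFunction) : ℝ := sSup {u : ℝ | 0 ≤ u ∧ Φ u = 0}

/-- Condition `Δ₂(ℝ₊)`. -/
def OrliczFunction.Delta2 (Φ : OrliczFunction) : Prop :=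
  ∃ K > 0, ∀ u : ℝ, 0 ≤ u → Φ (2 * u) ≤ K * Φ u

/-- Condition `Δ₂(∞)`. -/
def OrliczFunction.Delta2AtTop (Φ : OrliczFunction) : Prop :=
  ∃ u₀ > 0, ∃ K > 0, ∀ u : ℝ, u₀ ≤ u → Φ (2 * u) ≤ K * Φ u

/-- Condition `Δ₂(0)`. -/
def OrliczFunction.Delta2AtZero (Φ : OrliczFunction) : Prop :=
  ∃ u₀ > 0, ∃ K > 0, ∀ u : ℝ, 0 ≤ u → u ≤ u₀ → Φ (2 * u) ≤ K * Φ u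

/-- A norm `p` on `ℝ²` is a lattice norm if `|u| ≤ |u'|` and `|v| ≤ |v'|` imply
`p (u, v) ≤ p (u', v')`. -/
structure IsLatticeNorm (p : Seminorm ℝ (ℝ × ℝ)) : Prop where
  eq_zero : ∀ w, p w = 0 → w = 0
  mono : ∀ u v u' v' : ℝ, |u| ≤ |u'| → |v| ≤ |v'| → p (u, v) ≤ p (u', v')

section MonotonicityNotions

variable {X : Type*} [AddCommGroup X] [PartialOrder X]

/-- Strict monotonicity of the norm `N` on the ordered space `X`. -/
def StrictlyMonotone (N : X → ℝ) : Prop :=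
  ∀ x y : X, 0 ≤ x → x ≤ y → x ≠ y → N x < N y

/-- Uniform monotonicity of the norm `N` on the ordered space `X`. -/
def UniformlyMonotone (N : X → ℝ) : Prop :=
  ∀ ε ∈ Ioo (0 : ℝ) 1, ∃ δ ∈ Ioo (0 : ℝ) 1, ∀ x y : X,
    0 ≤ x → x ≤ y → ε ≤ N x → N y = 1 → N (y - x) ≤ 1 - δ

/-- Upper local uniform monotonicity of the norm `N` on the ordered space `X`. -/
def UpperLocallyUniformlyMonotone (N : X → ℝ) : Prop :=
  ∀ y : X, 0 ≤ y → N y = 1 → ∀ ε > 0, ∃ σ > 0, ∀ x : X,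
    0 ≤ x → ε ≤ N x → 1 + σ ≤ N (y + x)

end MonotonicityNotions

section Measure

variable {Ω : Type*} [MeasurableSpace Ω]

/-- `A` is an atom of `μ`. -/
def IsMeasureAtom (μ : Measure Ω) (A : Set Ω) : Prop :=
  MeasurableSet A ∧ 0 < μ A ∧
    ∀ B, MeasurableSet B → B ⊆ A → μ B = 0 ∨ μ (A \ B) = 0

/-- Every atom of `μ` is, up to a null set, a singleton, of measure one. -/
def HasUnitPointAtoms (μ : Measure Ω) : Prop :=
  ∀ A, IsMeasureAtom μ A → ∃ ω ∈ A, MeasurableSet {ω} ∧ μ {ω} = 1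

/-- The atomic part of the space: the points that are atoms. -/
def atomicPart (μ : Measure Ω) : Set Ω := {ω | MeasurableSet {ω} ∧ 0 < μ {ω}}

/-- The `Δ₂`-condition suitable for the measure `μ`: on the non-atomic part it is `Δ₂(ℝ₊)` or
`Δ₂(∞)` according to whether that part has infinite or finite positive measure, and `Δ₂(0)` is
required whenever there are infinitely many atoms. -/
def SuitableDelta2 (Φ : OrliczFunction) (μ : Measure Ω) : Prop :=
  (μ (atomicPart μ)ᶜ = ∞ → Φ.Delta2) ∧
  (0 < μ (atomicPart μ)ᶜ → μ (atomicPart μ)ᶜ < ∞ → Φ.Delta2AtTop) ∧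
  ((atomicPart μ).Infinite → Φ.Delta2AtZero)

variable {μ : Measure Ω}

/-- The modular `I_Φ(x) = ∫ Φ(x(t)) dμ`, with values in `[0, ∞]`. -/
def modular (Φ : OrliczFunction) (x : Ω →ₘ[μ] ℝ) : ℝ≥0∞ :=
  ∫⁻ t, ENNReal.ofReal (Φ (x t)) ∂μ

theorem OrliczFunction.le_of_abs_le (Φ : OrliczFunction) {u v : ℝ} (h : |u| ≤ |v|) :
    Φ u ≤ Φ v := by
  have habs : ∀ w, Φ |w| = Φ w := fun w => by
    rcases abs_choice w with h | h <;> rw [h]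
    exact Φ.even w
  rw [← habs v]
  have h1 : u ∈ segment ℝ (-|v|) |v| := by
    rw [segment_eq_Icc (by linarith [abs_nonneg v])]
    exact abs_le.mp h
  have := Φ.convex.le_on_segment (mem_univ _) (mem_univ _) h1
  rwa [Φ.even, max_self] at this

theorem modular_add_le (Φ : OrliczFunction) (c : ℝ) (x y : Ω →ₘ[μ] ℝ) :
    modular Φ ((c / 2) • (x + y)) ≤ modular Φ (c • x) + modular Φ (c • y) := by
  have hcont : Continuous Φ.toFun := by
    rw [← continuousOn_univ]
    exact Φ.convex.continuousOn isOpen_univ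
  have hm : AEMeasurable (fun t => ENNReal.ofReal (Φ ((c • x : Ω →ₘ[μ] ℝ) t))) μ :=
    (hcont.measurable.comp_aemeasurable (c • x : Ω →ₘ[μ] ℝ).aemeasurable).ennreal_ofReal
  unfold modular
  rw [← lintegral_add_left' hm]
  apply lintegral_mono_ae
  filter_upwards [AEEqFun.coeFn_smul (c / 2) (x + y), AEEqFun.coeFn_add x y,
    AEEqFun.coeFn_smul c x, AEEqFun.coeFn_smul c y] with t h1 h2 h3 h4
  rw [h1, h3, h4, ← ENNReal.ofReal_add (Φ.nonneg _) (Φ.nonneg _)]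
  apply ENNReal.ofReal_le_ofReal
  simp only [Pi.smul_apply, h2, Pi.add_apply, smul_eq_mul]
  have := Φ.convex.2 (mem_univ (c * x t)) (mem_univ (c * y t))
    (by norm_num : (0 : ℝ) ≤ 1 / 2) (by norm_num : (0 : ℝ) ≤ 1 / 2) (by norm_num)
  simp only [smul_eq_mul] at this
  have e : c / 2 * (x t + y t) = 1 / 2 * (c * x t) + 1 / 2 * (c * y t) := by ring
  rw [e]
  linarith [Φ.nonneg (c * x t), Φ.nonneg (c * y t)]

theorem modular_smul_le (Φ : OrliczFunction) {c d : ℝ} (h : |c| ≤ |d|) (x : Ω →ₘ[μ] ℝ) :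
    modular Φ (c • x) ≤ modular Φ (d • x) := by
  apply lintegral_mono_ae
  filter_upwards [AEEqFun.coeFn_smul c x, AEEqFun.coeFn_smul d x] with t h1 h2
  rw [h1, h2]
  apply ENNReal.ofReal_le_ofReal
  apply Φ.le_of_abs_le
  simp only [Pi.smul_apply, smul_eq_mul, abs_mul]
  gcongr

theorem modular_zero (Φ : OrliczFunction) : modular Φ (0 : Ω →ₘ[μ] ℝ) = 0 := by
  have h : modular Φ (0 : Ω →ₘ[μ] ℝ) = ∫⁻ _ : Ω, 0 ∂μ := by
    apply lintegral_congr_ae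
    filter_upwards [AEEqFun.coeFn_zero (α := Ω) (β := ℝ) (μ := μ)] with t h1
    rw [h1]
    simp [Φ.map_zero]
  rw [h, lintegral_zero]

variable (Φ : OrliczFunction) (μ)

/-- The Orlicz space `L^Φ(μ)`: classes `x` of measurable functions with `I_Φ(l x) < ∞` for some
`l > 0`. -/
def orliczSpace : Submodule ℝ (Ω →ₘ[μ] ℝ) where
  carrier := {x | ∃ l : ℝ, 0 < l ∧ modular Φ (l • x) < ∞}
  zero_mem' := ⟨1, one_pos, by rw [smul_zero, modular_zero]; exact ENNReal.zero_lt_top⟩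
  add_mem' := by
    rintro x y ⟨l, hl, hx⟩ ⟨m, hm, hy⟩
    have h0 : 0 < min l m := lt_min hl hm
    refine ⟨min l m / 2, by positivity, (modular_add_le Φ _ x y).trans_lt ?_⟩
    refine ENNReal.add_lt_top.2 ⟨(modular_smul_le Φ ?_ x).trans_lt hx,
      (modular_smul_le Φ ?_ y).trans_lt hy⟩
    · rw [abs_of_pos h0, abs_of_pos hl]; exact min_le_left _ _
    · rw [abs_of_pos h0, abs_of_pos hm]; exact min_le_right _ _
  smul_mem' := by
    rintro c x ⟨l, hl, hx⟩
    have h0 : 0 < |c| + 1 := by positivity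
    refine ⟨l / (|c| + 1), by positivity, ?_⟩
    rw [smul_smul]
    refine (modular_smul_le Φ ?_ x).trans_lt hx
    rw [abs_mul, abs_div, abs_of_pos hl, abs_of_pos h0, div_mul_eq_mul_div, div_le_iff₀ h0]
    nlinarith

/-- The space `E^Φ(μ)`: classes `x` of measurable functions with `I_Φ(l x) < ∞` for all
`l > 0`. -/
def orliczHeart : Submodule ℝ (Ω →ₘ[μ] ℝ) where
  carrier := {x | ∀ l : ℝ, 0 < l → modular Φ (l • x) < ∞}
  zero_mem' := fun l _ => by rw [smul_zero, modular_zero]; exact ENNReal.zero_lt_top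
  add_mem' := by
    intro x y hx hy l hl
    have := modular_add_le Φ (2 * l) x y
    rw [mul_div_cancel_left₀ l two_ne_zero] at this
    exact this.trans_lt (ENNReal.add_lt_top.2
      ⟨hx (2 * l) (by positivity), hy (2 * l) (by positivity)⟩)
  smul_mem' := by
    intro c x hx l hl
    rw [smul_smul]
    have h0 : 0 < l * (|c| + 1) := by positivity
    refine (modular_smul_le Φ ?_ x).trans_lt (hx _ h0)
    rw [abs_mul, abs_of_pos hl, abs_of_pos h0]
    nlinarith

variable {μ} (p : Seminorm ℝ (ℝ × ℝ))

/-- `‖x‖_{Φ,p} = inf_{k > 0} (1/k) p(1, I_Φ(k x))`. The values of `k` with `I_Φ(k x) = ∞`, at which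
the expression is `+∞`, do not contribute to the infimum; for `x` in the Orlicz space some `k`
contributes. -/
def pNorm (x : Ω →ₘ[μ] ℝ) : ℝ :=
  sInf {r : ℝ | ∃ k : ℝ, 0 < k ∧ modular Φ (k • x) < ∞ ∧
    r = 1 / k * p (1, (modular Φ (k • x)).toReal)}

/-- `K(x)`: the set of all `k ∈ (0, ∞)` at which the infimum defining `‖x‖_{Φ,p}` is attained. -/
def minimizers (x : Ω →ₘ[μ] ℝ) : Set ℝ :=
  {k : ℝ | 0 < k ∧ modular Φ (k • x) < ∞ ∧
    pNorm Φ p x = 1 / k * p (1, (modular Φ (k • x)).toReal)}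

variable (μ)

/-- The norm `‖·‖_{Φ,p}` on `L^Φ(μ)`. -/
def normL (x : orliczSpace μ Φ) : ℝ := pNorm Φ p (x : Ω →ₘ[μ] ℝ)

/-- The norm `‖·‖_{Φ,p}` on `E^Φ(μ)`. -/
def normE (x : orliczHeart μ Φ) : ℝ := pNorm Φ p (x : Ω →ₘ[μ] ℝ)

end Measure

end OrliczLattice

end

open OrliczLattice

/-! For (i) ⇒ (ii), the `Δ₂`-condition and `a(Φ) = 0` turn a lower bound on the norm of `x` into a
lower bound on `I(x/2)` (`SuitableDelta2.exists_le_modular`). Let `0 ≤ x ≤ y`, `‖y‖ = 1`, and let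
`k` nearly attain the infimum for `y`. Superadditivity of `Φ` gives `I(k(y - x)) ≤ I(ky) - I(kx)`,
so the second coordinate of `(1/k, I(ky)/k)` drops by a fixed amount on passing to `y - x`. That
point stays in a compact set, where strict monotonicity of `p` makes the loss of norm uniform.

(ii) ⇒ (iii) follows by normalising `y + x`, and (iii) ⇒ (iv) because `E^Φ` sits in `L^Φ` with the
same norm.

For (iv) ⇒ (i), take `y` of norm one supported on `A`, a minimizer `k` for `y`, and `x = k⁻¹ u 1_B`
with `B` disjoint from `A`. Testing the infimum for `y + x` at this `k` gives `‖y + x‖ ≤ 1 + Φ(u)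
μ(B) / k`. Hence step functions off `A` with norm bounded below have modular bounded below
(`exists_le_modular_constOn`). A positive zero of `Φ` contradicts this at once. Taking `μ(B)`
comparable to `1/Φ(2u)` gives `Φ(2u) ≤ K Φ(u)`. The sets `B` come from a weak intermediate value
property on the nonatomic part and from counting atoms on the atomic part. -/

open Filter Topology

namespace OrliczLattice

/-! ### Elementary properties of Orlicz functions. -/

namespace OrliczFunction

variable (Φ : OrliczFunction)

theorem continuous : Continuous Φ.toFun := by
  rw [← continuousOn_univ]
  exact Φ.convex.continuousOn isOpen_univ

theorem mono {u v : ℝ} (hu : 0 ≤ u) (huv : u ≤ v) : Φ u ≤ Φ v :=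
  Φ.le_of_abs_le (by rwa [abs_of_nonneg hu, abs_of_nonneg (hu.trans huv)])

theorem abs_apply (u : ℝ) : Φ |u| = Φ u := by
  rcases abs_choice u with h | h <;> rw [h]
  exact Φ.even u

theorem scale_le {t : ℝ} (h0 : 0 ≤ t) (h1 : t ≤ 1) (u : ℝ) : Φ (t * u) ≤ t * Φ u := by
  have := Φ.convex.2 (mem_univ u) (mem_univ 0) h0 (sub_nonneg.2 h1) (by ring)
  simpa [Φ.map_zero] using this

/-- The scaling inequality is applied with the two fractions `v/u` and `(u - v)/u`, which sum to
one. -/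
theorem superadditive {u v : ℝ} (hv : 0 ≤ v) (hvu : v ≤ u) : Φ (u - v) + Φ v ≤ Φ u := by
  rcases (hv.trans hvu).eq_or_lt with h | h
  · have : v = 0 := by linarith
    subst this
    simp [Φ.map_zero]
  · have h1 := Φ.scale_le (t := v / u) (by positivity) (by rwa [div_le_one h]) u
    have h2 := Φ.scale_le (t := (u - v) / u) (div_nonneg (by linarith) h.le)
      (by rw [div_le_one h]; linarith) u
    rw [div_mul_cancel₀ _ h.ne'] at h1 h2
    have h3 : (u - v) / u * Φ u + v / u * Φ u = Φ u := by field_simp; ring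
    linarith

theorem exists_pos_apply_pos : ∃ u > 0, 0 < Φ u := by
  obtain ⟨u, hu⟩ := Φ.ne_zero
  have hu0 : u ≠ 0 := fun h => hu (h ▸ Φ.map_zero)
  exact ⟨|u|, abs_pos.2 hu0, by rw [Φ.abs_apply]; exact (Φ.nonneg u).lt_of_ne' hu⟩

theorem exists_le_apply (M : ℝ) : ∃ u > 0, M ≤ Φ u := by
  obtain ⟨u, hu, hΦ⟩ := Φ.exists_pos_apply_pos
  have h1 : 1 ≤ |M| / Φ u + 1 := by
    have : 0 ≤ |M| / Φ u := by positivity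
    linarith
  have h0 : 0 < |M| / Φ u + 1 := by linarith
  refine ⟨(|M| / Φ u + 1) * u, by positivity, ?_⟩
  have h2 := Φ.scale_le (t := (|M| / Φ u + 1)⁻¹) (by positivity) (inv_le_one_of_one_le₀ h1)
    ((|M| / Φ u + 1) * u)
  rw [inv_mul_cancel_left₀ h0.ne', inv_mul_eq_div, le_div_iff₀ h0] at h2
  have h3 : Φ u * (|M| / Φ u + 1) = |M| + Φ u := by field_simp
  linarith [le_abs_self M]

theorem exists_apply_le {e : ℝ} (he : 0 < e) : ∃ u > 0, Φ u ≤ e := by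
  have h1 := Φ.nonneg 1
  refine ⟨min 1 (e / (Φ 1 + 1)), by positivity, ?_⟩
  have h2 := Φ.scale_le (t := min 1 (e / (Φ 1 + 1))) (by positivity) (min_le_left _ _) 1
  rw [mul_one] at h2
  refine h2.trans ((mul_le_mul_of_nonneg_right (min_le_right _ _) h1).trans ?_)
  rw [div_mul_eq_mul_div, div_le_iff₀ (by linarith)]
  nlinarith

theorem bddAbove_zeros : BddAbove {u : ℝ | 0 ≤ u ∧ Φ u = 0} := by
  obtain ⟨v, hv, hΦ⟩ := Φ.exists_pos_apply_pos
  refine ⟨v, fun u hu => ?_⟩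
  by_contra! h
  have := Φ.mono hv.le h.le
  rw [hu.2] at this
  linarith

theorem pos_of_a_eq_zero (ha : Φ.a = 0) {u : ℝ} (hu : 0 < u) : 0 < Φ u := by
  refine (Φ.nonneg u).lt_of_ne' fun h => ?_
  have : u ≤ Φ.a := le_csSup Φ.bddAbove_zeros ⟨hu.le, h⟩
  linarith

theorem exists_zero_of_a_ne_zero (ha : Φ.a ≠ 0) : ∃ u > 0, Φ u = 0 := by
  by_contra! h
  refine ha ?_
  have : {u : ℝ | 0 ≤ u ∧ Φ u = 0} = {0} := by
    ext u
    refine ⟨fun hu => ?_, fun hu => ?_⟩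
    · by_contra h0
      exact h u (hu.1.lt_of_ne' h0) hu.2
    · rw [mem_singleton_iff.1 hu]
      exact ⟨le_rfl, Φ.map_zero⟩
  rw [a, this, csSup_singleton]

end OrliczFunction

/-! ### Lattice norms on the plane. -/

section LatticeNorm

variable {p : Seminorm ℝ (ℝ × ℝ)}

theorem apply_le_abs_add_abs (hp10 : p (1, 0) = 1) (hp01 : p (0, 1) = 1) (u v : ℝ) :
    p (u, v) ≤ |u| + |v| := by
  have h : (u, v) = u • ((1 : ℝ), (0 : ℝ)) + v • ((0 : ℝ), (1 : ℝ)) := by simp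
  rw [h]
  refine (map_add_le_add p _ _).trans ?_
  rw [map_smul_eq_mul, map_smul_eq_mul, hp10, hp01]
  simp

theorem continuous_latticeNorm (hp10 : p (1, 0) = 1) (hp01 : p (0, 1) = 1) :
    Continuous fun w : ℝ × ℝ => p w := by
  refine continuous_iff_continuousAt.2 fun w => ?_
  rw [ContinuousAt, tendsto_iff_dist_tendsto_zero]
  have h : Tendsto (fun z : ℝ × ℝ => |z.1 - w.1| + |z.2 - w.2|) (𝓝 w) (𝓝 0) := by
    have : Continuous fun z : ℝ × ℝ => |z.1 - w.1| + |z.2 - w.2| := by fun_prop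
    simpa using this.tendsto w
  refine squeeze_zero (fun _ => dist_nonneg) (fun z => ?_) h
  rw [Real.dist_eq]
  refine (abs_sub_map_le_sub p z w).trans ?_
  exact apply_le_abs_add_abs hp10 hp01 _ _

theorem one_le_latticeNorm (hp : IsLatticeNorm p) (hp10 : p (1, 0) = 1) (s : ℝ) :
    1 ≤ p (1, s) := by
  exact hp10.symm.le.trans (hp.mono _ _ _ _ le_rfl (by simp))

theorem le_latticeNorm (hp : IsLatticeNorm p) (hp01 : p (0, 1) = 1) (t s : ℝ) :
    s ≤ p (t, s) := by
  have h : (0, s) = s • ((0 : ℝ), (1 : ℝ)) := by simp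
  have h1 : p (0, s) = |s| := by rw [h, map_smul_eq_mul, hp01]; simp
  calc s ≤ |s| := le_abs_self s
    _ = p (0, s) := h1.symm
    _ ≤ p (t, s) := hp.mono _ _ _ _ (by simp) le_rfl

theorem latticeNorm_add_le (hp01 : p (0, 1) = 1) (t s : ℝ) {r : ℝ} (hr : 0 ≤ r) :
    p (t, s + r) ≤ p (t, s) + r := by
  have h : (t, s + r) = (t, s) + r • ((0 : ℝ), (1 : ℝ)) := by simp
  rw [h]
  refine (map_add_le_add p _ _).trans ?_
  rw [map_smul_eq_mul, hp01, Real.norm_of_nonneg hr, mul_one]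

theorem mul_latticeNorm {c : ℝ} (hc : 0 ≤ c) (t s : ℝ) : c * p (t, s) = p (c * t, c * s) := by
  have h : (c * t, c * s) = c • (t, s) := by simp
  rw [h, map_smul_eq_mul, Real.norm_of_nonneg hc]

end LatticeNorm

/-! ### Order, modular and norm on classes of functions. -/

section Order

variable {Ω : Type*} [MeasurableSpace Ω] {μ : Measure Ω}

theorem ae_nonneg {x : Ω →ₘ[μ] ℝ} (hx : 0 ≤ x) : ∀ᵐ t ∂μ, 0 ≤ x t := by
  filter_upwards [AEEqFun.coeFn_le.2 hx, AEEqFun.coeFn_zero (α := Ω) (β := ℝ) (μ := μ)]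
    with t h1 h2
  rwa [h2] at h1

theorem smul_le_smul_ae {c : ℝ} (hc : 0 ≤ c) {x y : Ω →ₘ[μ] ℝ} (h : x ≤ y) :
    c • x ≤ c • y := by
  rw [← AEEqFun.coeFn_le] at h ⊢
  filter_upwards [h, AEEqFun.coeFn_smul c x, AEEqFun.coeFn_smul c y] with t h1 h2 h3
  rw [h2, h3]
  exact mul_le_mul_of_nonneg_left h1 hc

theorem le_add_ae {x y : Ω →ₘ[μ] ℝ} (hx : 0 ≤ x) : y ≤ y + x := by
  rw [← AEEqFun.coeFn_le]
  filter_upwards [ae_nonneg hx, AEEqFun.coeFn_add y x] with t h1 h2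
  rw [h2]
  exact le_add_of_nonneg_right h1

end Order

section Modular

variable {Ω : Type*} [MeasurableSpace Ω] {μ : Measure Ω} {Φ : OrliczFunction}

theorem aemeasurable_modular (x : Ω →ₘ[μ] ℝ) :
    AEMeasurable (fun t => ENNReal.ofReal (Φ (x t))) μ :=
  (Φ.continuous.measurable.comp_aemeasurable x.aemeasurable).ennreal_ofReal

theorem modular_smul (c : ℝ) (x : Ω →ₘ[μ] ℝ) :
    modular Φ (c • x) = ∫⁻ t, ENNReal.ofReal (Φ (c * x t)) ∂μ := by
  refine lintegral_congr_ae ?_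
  filter_upwards [AEEqFun.coeFn_smul c x] with t h
  rw [h, Pi.smul_apply, smul_eq_mul]

theorem modular_mono {x y : Ω →ₘ[μ] ℝ} (hx : 0 ≤ x) (hxy : x ≤ y) :
    modular Φ x ≤ modular Φ y := by
  refine lintegral_mono_ae ?_
  filter_upwards [ae_nonneg hx, AEEqFun.coeFn_le.2 hxy] with t h1 h2
  exact ENNReal.ofReal_le_ofReal (Φ.mono h1 h2)

theorem modular_sub_add_le {x y : Ω →ₘ[μ] ℝ} (hx : 0 ≤ x) (hxy : x ≤ y) :
    modular Φ (y - x) + modular Φ x ≤ modular Φ y := by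
  unfold modular
  rw [← lintegral_add_left' (aemeasurable_modular _)]
  refine lintegral_mono_ae ?_
  filter_upwards [ae_nonneg hx, AEEqFun.coeFn_le.2 hxy, AEEqFun.coeFn_sub y x] with t h1 h2 h4
  rw [h4, Pi.sub_apply, ← ENNReal.ofReal_add (Φ.nonneg _) (Φ.nonneg _)]
  exact ENNReal.ofReal_le_ofReal (Φ.superadditive h1 h2)

theorem modular_scale_le {t : ℝ} (h0 : 0 ≤ t) (h1 : t ≤ 1) (x : Ω →ₘ[μ] ℝ) :
    modular Φ (t • x) ≤ ENNReal.ofReal t * modular Φ x := by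
  rw [modular_smul, modular, ← lintegral_const_mul'' _ (aemeasurable_modular x)]
  refine lintegral_mono fun s => ?_
  rw [← ENNReal.ofReal_mul h0]
  exact ENNReal.ofReal_le_ofReal (Φ.scale_le h0 h1 _)

/-- For `k ≥ 1`, `k I(x) ≤ I(kx)`. -/
theorem mul_modular_le {k : ℝ} (hk : 1 ≤ k) (x : Ω →ₘ[μ] ℝ) :
    ENNReal.ofReal k * modular Φ x ≤ modular Φ (k • x) := by
  have h0 : 0 < k := by linarith
  have h := modular_scale_le (Φ := Φ) (t := k⁻¹) (by positivity) (inv_le_one_of_one_le₀ hk) (k • x)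
  rw [inv_smul_smul₀ h0.ne'] at h
  refine (mul_le_mul_right h _).trans ?_
  rw [← mul_assoc, ← ENNReal.ofReal_mul h0.le, mul_inv_cancel₀ h0.ne', ENNReal.ofReal_one, one_mul]

end Modular

section Norm

variable {Ω : Type*} [MeasurableSpace Ω] {μ : Measure Ω} {Φ : OrliczFunction}
  {p : Seminorm ℝ (ℝ × ℝ)}

theorem orliczHeart_le_orliczSpace : orliczHeart μ Φ ≤ orliczSpace μ Φ :=
  fun _ hx => ⟨1, one_pos, hx 1 one_pos⟩

theorem pNorm_le {x : Ω →ₘ[μ] ℝ} {k : ℝ} (hk : 0 < k) (hx : modular Φ (k • x) < ∞) :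
    pNorm Φ p x ≤ 1 / k * p (1, (modular Φ (k • x)).toReal) := by
  refine csInf_le ⟨0, ?_⟩ ⟨k, hk, hx, rfl⟩
  rintro _ ⟨l, hl, _, rfl⟩
  exact mul_nonneg (by positivity) (apply_nonneg p _)

/-- Membership in `L^Φ` makes the set under `sInf` nonempty; for an empty set the real infimum would
be the default value `0`. -/
theorem exists_lt_of_pNorm_lt {x : Ω →ₘ[μ] ℝ} (hx : x ∈ orliczSpace μ Φ) {r : ℝ}
    (h : pNorm Φ p x < r) :
    ∃ k : ℝ, 0 < k ∧ modular Φ (k • x) < ∞ ∧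
      1 / k * p (1, (modular Φ (k • x)).toReal) < r := by
  obtain ⟨l, hl, hlx⟩ := hx
  obtain ⟨_, ⟨k, hk, hkx, rfl⟩, hr⟩ := exists_lt_of_csInf_lt (by exact ⟨_, l, hl, hlx, rfl⟩) h
  exact ⟨k, hk, hkx, hr⟩

theorem le_pNorm {x : Ω →ₘ[μ] ℝ} (hx : x ∈ orliczSpace μ Φ) {r : ℝ}
    (h : ∀ k : ℝ, 0 < k → modular Φ (k • x) < ∞ →
      r ≤ 1 / k * p (1, (modular Φ (k • x)).toReal)) : r ≤ pNorm Φ p x := by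
  by_contra! hr
  obtain ⟨k, hk, hkx, h1⟩ := exists_lt_of_pNorm_lt hx hr
  exact (h k hk hkx).not_gt h1

theorem pNorm_smul_le {x : Ω →ₘ[μ] ℝ} (hx : x ∈ orliczSpace μ Φ) {c : ℝ} (hc : 0 < c) :
    pNorm Φ p (c • x) ≤ c * pNorm Φ p x := by
  rw [← div_le_iff₀' hc]
  refine le_pNorm hx fun k hk hkx => ?_
  have e : (k / c) • c • x = k • x := by rw [smul_smul, div_mul_cancel₀ _ hc.ne']
  have h := pNorm_le (Φ := Φ) (p := p) (x := c • x) (k := k / c) (by positivity) (by rwa [e])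
  rw [e] at h
  rw [div_le_iff₀ hc]
  refine h.trans_eq ?_
  field_simp

theorem pNorm_smul {x : Ω →ₘ[μ] ℝ} (hx : x ∈ orliczSpace μ Φ) {c : ℝ} (hc : 0 < c) :
    pNorm Φ p (c • x) = c * pNorm Φ p x := by
  refine (pNorm_smul_le hx hc).antisymm ?_
  have h := pNorm_smul_le (p := p) ((orliczSpace μ Φ).smul_mem c hx) (inv_pos.2 hc)
  rw [inv_smul_smul₀ hc.ne', inv_mul_eq_div, le_div_iff₀ hc] at h
  linarith

theorem pNorm_mono (hp : IsLatticeNorm p) {x y : Ω →ₘ[μ] ℝ} (hy : y ∈ orliczSpace μ Φ)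
    (h0 : 0 ≤ x) (hxy : x ≤ y) : pNorm Φ p x ≤ pNorm Φ p y := by
  refine le_pNorm hy fun k hk hky => ?_
  have h : modular Φ (k • x) ≤ modular Φ (k • y) :=
    modular_mono (by simpa using smul_le_smul_ae hk.le h0) (smul_le_smul_ae hk.le hxy)
  refine (pNorm_le hk (h.trans_lt hky)).trans ?_
  refine mul_le_mul_of_nonneg_left (hp.mono _ _ _ _ le_rfl ?_) (by positivity)
  rw [abs_of_nonneg ENNReal.toReal_nonneg, abs_of_nonneg ENNReal.toReal_nonneg]
  exact ENNReal.toReal_mono hky.ne h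

/-- For `k ≤ 1` the first coordinate gives `p(1, ·)/k ≥ 1 ≥ r`; for `k ≥ 1` the second gives
`I(kx)/k ≥ I(x) ≥ r`. -/
theorem le_pNorm_of_le_modular (hp : IsLatticeNorm p) (hp10 : p (1, 0) = 1)
    (hp01 : p (0, 1) = 1) {x : Ω →ₘ[μ] ℝ} (hx : x ∈ orliczSpace μ Φ) {r : ℝ} (h0 : 0 ≤ r)
    (h1 : r ≤ 1) (hr : ENNReal.ofReal r ≤ modular Φ x) : r ≤ pNorm Φ p x := by
  refine le_pNorm hx fun k hk hkx => ?_
  rw [one_div_mul_eq_div, le_div_iff₀ hk]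
  rcases le_total k 1 with hk1 | hk1
  · nlinarith [one_le_latticeNorm hp hp10 (modular Φ (k • x)).toReal]
  · refine le_trans ?_ (le_latticeNorm hp hp01 _ _)
    rw [← ENNReal.ofReal_le_iff_le_toReal hkx.ne, mul_comm, ENNReal.ofReal_mul hk.le]
    exact (mul_le_mul_right hr _).trans (mul_modular_le hk1 x)

end Norm

/-! ### The implications (ii) ⇒ (iii) ⇒ (iv). -/

section Implications

variable {Ω : Type*} [MeasurableSpace Ω] {μ : Measure Ω} {Φ : OrliczFunction}
  {p : Seminorm ℝ (ℝ × ℝ)}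

theorem UniformlyMonotone.upperLocallyUniformlyMonotone_normL (hp : IsLatticeNorm p)
    (h : UniformlyMonotone (normL μ Φ p)) : UpperLocallyUniformlyMonotone (normL μ Φ p) := by
  intro y hy hy1 ε hε
  obtain ⟨δ, ⟨hδ0, hδ1⟩, hδ⟩ := h (min (ε / 2) (1 / 2)) ⟨by positivity, by
    linarith [min_le_right (ε / 2) (1 / 2)]⟩
  refine ⟨δ, hδ0, fun x hx hεx => ?_⟩
  set s := normL μ Φ p (y + x) with hs
  have hs1 : 1 ≤ s := by
    rw [← hy1]
    exact pNorm_mono hp (y + x).2 hy (le_add_ae hx)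
  -- A norm of at least `2` already exceeds `1 + δ`. Otherwise dividing by `s` costs `x` at most
  -- half its norm, whence the parameter `ε/2`, and `1/s ≤ 1 - δ` yields `s ≥ 1 + δ`.
  rcases le_total 2 s with h2 | h2
  · linarith
  have hs0 : 0 < s := by linarith
  have hsmul : ∀ z : orliczSpace μ Φ, normL μ Φ p (s⁻¹ • z) = s⁻¹ * normL μ Φ p z := fun z =>
    pNorm_smul z.2 (inv_pos.2 hs0)
  have e : s⁻¹ • (y + x) - s⁻¹ • x = s⁻¹ • y := by rw [smul_add, add_sub_cancel_right]
  have hx0 : (0 : Ω →ₘ[μ] ℝ) ≤ x := hx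
  have hle : (x : Ω →ₘ[μ] ℝ) ≤ y + x := by
    rw [add_comm]
    exact le_add_ae hy
  have h3 := hδ (s⁻¹ • x) (s⁻¹ • (y + x))
    (show (0 : Ω →ₘ[μ] ℝ) ≤ s⁻¹ • (x : Ω →ₘ[μ] ℝ) by
      simpa using smul_le_smul_ae (inv_nonneg.2 hs0.le) hx0)
    (smul_le_smul_ae (inv_nonneg.2 hs0.le) hle) ?_ ?_
  · rw [e, hsmul, hy1, mul_one, inv_le_iff_one_le_mul₀ hs0] at h3
    nlinarith
  · rw [hsmul, inv_mul_eq_div, le_div_iff₀ hs0]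
    nlinarith [min_le_left (ε / 2) (1 / 2)]
  · rw [hsmul, ← hs, inv_mul_cancel₀ hs0.ne']

theorem UpperLocallyUniformlyMonotone.normE
    (h : UpperLocallyUniformlyMonotone (normL μ Φ p)) :
    UpperLocallyUniformlyMonotone (normE μ Φ p) := by
  intro y hy hy1 ε hε
  obtain ⟨σ, hσ, hx⟩ := h ⟨y, orliczHeart_le_orliczSpace y.2⟩ hy hy1 ε hε
  exact ⟨σ, hσ, fun x h0 h1 => hx ⟨x, orliczHeart_le_orliczSpace x.2⟩ h0 h1⟩

end Implications

/-! ### Iterated `Δ₂`-conditions. -/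

namespace OrliczFunction

variable (Φ : OrliczFunction)

theorem iterate_delta2 {K : ℝ} (hK : 0 ≤ K) (n : ℕ) {u : ℝ}
    (h : ∀ i < n, Φ (2 * (2 ^ i * u)) ≤ K * Φ (2 ^ i * u)) : Φ (2 ^ n * u) ≤ K ^ n * Φ u := by
  induction n with
  | zero => simp
  | succ n ih =>
    have h1 := ih fun i hi => h i (hi.trans n.lt_succ_self)
    have h2 := h n n.lt_succ_self
    rw [show (2 : ℝ) ^ (n + 1) * u = 2 * (2 ^ n * u) by ring]
    calc Φ (2 * (2 ^ n * u)) ≤ K * Φ (2 ^ n * u) := h2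
      _ ≤ K * (K ^ n * Φ u) := mul_le_mul_of_nonneg_left h1 hK
      _ = K ^ (n + 1) * Φ u := by ring

theorem Delta2.iterate {Φ : OrliczFunction} (h : Φ.Delta2) (n : ℕ) :
    ∃ C ≥ 0, ∀ u : ℝ, 0 ≤ u → Φ (2 ^ n * u) ≤ C * Φ u := by
  obtain ⟨K, hK, h⟩ := h
  exact ⟨K ^ n, by positivity, fun u hu =>
    Φ.iterate_delta2 hK.le n fun i _ => h _ (by positivity)⟩

theorem Delta2AtZero.iterate {Φ : OrliczFunction} (h : Φ.Delta2AtZero) (n : ℕ) :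
    ∃ u₀ > 0, ∃ C ≥ 0, ∀ u : ℝ, 0 ≤ u → u ≤ u₀ → Φ (2 ^ n * u) ≤ C * Φ u := by
  obtain ⟨u₀, hu₀, K, hK, h⟩ := h
  refine ⟨u₀ / 2 ^ n, by positivity, K ^ n, by positivity, fun u hu hu1 =>
    Φ.iterate_delta2 hK.le n fun i hi => h _ (by positivity) ?_⟩
  rw [le_div_iff₀' (by positivity)] at hu1
  refine le_trans (mul_le_mul_of_nonneg_right ?_ hu) hu1
  exact pow_le_pow_right₀ (by norm_num) hi.le

/-- If `Φ` vanishes only at zero, then the threshold in `Δ₂(∞)` can be taken arbitrarily small. -/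
theorem Delta2AtTop.iterate {Φ : OrliczFunction} (ha : Φ.a = 0) (h : Φ.Delta2AtTop) (n : ℕ)
    {u₁ : ℝ} (hu₁ : 0 < u₁) :
    ∃ C ≥ 0, ∀ u : ℝ, u₁ ≤ u → Φ (2 ^ n * u) ≤ C * Φ u := by
  obtain ⟨u₀, hu₀, K, hK, h⟩ := h
  have hΦ := Φ.pos_of_a_eq_zero ha hu₁
  -- Between `u₁` and `u₀` the ratio `Φ(2v)/Φ(v)` is at most `Φ(2u₀)/Φ(u₁)`, and `Φ(u₁) > 0` because
  -- `a(Φ) = 0`.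
  have hK' : 0 ≤ max K (Φ (2 * u₀) / Φ u₁) := hK.le.trans (le_max_left _ _)
  refine ⟨max K (Φ (2 * u₀) / Φ u₁) ^ n, by positivity, fun u hu =>
    Φ.iterate_delta2 hK' n fun i _ => ?_⟩
  have h1 : u₁ ≤ 2 ^ i * u := by
    have : (1 : ℝ) ≤ 2 ^ i := one_le_pow₀ (by norm_num)
    nlinarith
  generalize 2 ^ i * u = v at h1
  rcases le_total u₀ v with hv | hv
  · exact (h v hv).trans (mul_le_mul_of_nonneg_right (le_max_left _ _) (Φ.nonneg v))
  · calc Φ (2 * v) ≤ Φ (2 * u₀) := Φ.mono (by linarith) (by linarith)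
      _ = Φ (2 * u₀) / Φ u₁ * Φ u₁ := by field_simp
      _ ≤ max K (Φ (2 * u₀) / Φ u₁) * Φ v :=
        mul_le_mul (le_max_right _ _) (Φ.mono hu₁.le h1) hΦ.le hK'

end OrliczFunction

/-! ### The atomic part. -/

section Atoms

variable {Ω : Type*} [MeasurableSpace Ω] {μ : Measure Ω}

theorem countable_atomicPart (μ : Measure Ω) [SigmaFinite μ] : (atomicPart μ).Countable := by
  have h := Measure.countable_meas_pos_of_disjoint_iUnion (μ := μ)
    (As := fun ω : atomicPart μ => {(ω : Ω)}) (fun ω => ω.2.1)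
    (fun ω ω' h => by simpa [Function.onFun] using fun e => h (Subtype.ext e))
  have h' : {ω : atomicPart μ | 0 < μ {(ω : Ω)}} = univ := eq_univ_of_forall fun ω => ω.2.2
  rw [h'] at h
  exact countable_coe_iff.1 (countable_univ_iff.1 h)

theorem measurableSet_of_subset_atomicPart [SigmaFinite μ] {S : Set Ω} (h : S ⊆ atomicPart μ) :
    MeasurableSet S := by
  rw [← biUnion_of_singleton S]
  exact MeasurableSet.biUnion ((countable_atomicPart μ).mono h) fun ω hω => (h hω).1

theorem measurableSet_atomicPart (μ : Measure Ω) [SigmaFinite μ] :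
    MeasurableSet (atomicPart μ) :=
  measurableSet_of_subset_atomicPart Subset.rfl

theorem HasUnitPointAtoms.measure_singleton (hμ : HasUnitPointAtoms μ) {ω : Ω}
    (hω : ω ∈ atomicPart μ) : μ {ω} = 1 := by
  obtain ⟨ω', h, _, h1⟩ := hμ {ω} ⟨hω.1, hω.2, fun B _ hB => by
    rcases subset_singleton_iff_eq.1 hB with rfl | rfl <;> simp⟩
  rwa [mem_singleton_iff.1 h] at h1

/-- Markov's inequality: an atom of mass one where `Φ ∘ x ≥ c` alone contributes `c` to the modular.
-/
theorem apply_lt_of_modular_lt (hμ : HasUnitPointAtoms μ) {Φ : OrliczFunction} {c : ℝ}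
    {x : Ω →ₘ[μ] ℝ} (hx : modular Φ x < ENNReal.ofReal c) {ω : Ω}
    (hω : ω ∈ atomicPart μ) : Φ (x ω) < c := by
  by_contra! h
  refine hx.not_ge ?_
  refine le_trans ?_ (mul_meas_ge_le_lintegral₀ (aemeasurable_modular x) (ENNReal.ofReal c))
  have h1 : 1 ≤ μ {t | ENNReal.ofReal c ≤ ENNReal.ofReal (Φ (x t))} := by
    rw [← hμ.measure_singleton hω]
    exact measure_mono (singleton_subset_iff.2 (ENNReal.ofReal_le_ofReal h))
  calc ENNReal.ofReal c = ENNReal.ofReal c * 1 := (mul_one _).symm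
    _ ≤ _ := by gcongr

end Atoms

/-! ### From the `Δ₂`-condition to uniform monotonicity. -/

section Smallness

variable {Ω : Type*} [MeasurableSpace Ω] {μ : Measure Ω} {Φ : OrliczFunction}

/-- Common frame for all cases of the `Δ₂`-condition: the constant `m` accounts for one quarter of
the integral, and `c` is chosen so that `C` times the modular accounts for another. -/
theorem setLIntegral_le_of_pointwise {S : Set Ω} (hS : MeasurableSet S) {k m C c₀ : ℝ}
    (hm : 0 ≤ m) (hC : 0 ≤ C) (hc₀ : 0 < c₀) (hmS : ENNReal.ofReal m * μ S ≤ ENNReal.ofReal (1 / 4))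
    (h : ∀ x : Ω →ₘ[μ] ℝ, modular Φ x < ENNReal.ofReal c₀ →
      ∀ t ∈ S, Φ (k * x t) ≤ m + C * Φ (x t)) :
    ∃ c > 0, ∀ x : Ω →ₘ[μ] ℝ, modular Φ x < ENNReal.ofReal c →
      ∫⁻ t in S, ENNReal.ofReal (Φ (k * x t)) ∂μ ≤ ENNReal.ofReal (1 / 2) := by
  refine ⟨min c₀ (1 / (4 * (C + 1))), by positivity, fun x hx => ?_⟩
  have hx0 := hx.trans_le (ENNReal.ofReal_le_ofReal (min_le_left _ _))
  have hx1 := hx.trans_le (ENNReal.ofReal_le_ofReal (min_le_right _ _))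
  calc ∫⁻ t in S, ENNReal.ofReal (Φ (k * x t)) ∂μ
      ≤ ∫⁻ t in S, (ENNReal.ofReal m + ENNReal.ofReal C * ENNReal.ofReal (Φ (x t))) ∂μ := by
        refine setLIntegral_mono_ae' hS (Filter.Eventually.of_forall fun t ht => ?_)
        rw [← ENNReal.ofReal_mul hC, ← ENNReal.ofReal_add hm (mul_nonneg hC (Φ.nonneg _))]
        exact ENNReal.ofReal_le_ofReal (h x hx0 t ht)
    _ = ENNReal.ofReal m * μ S +
        ENNReal.ofReal C * ∫⁻ t in S, ENNReal.ofReal (Φ (x t)) ∂μ := by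
        rw [lintegral_add_left measurable_const, setLIntegral_const,
          lintegral_const_mul'' _ (aemeasurable_modular x).restrict]
    _ ≤ ENNReal.ofReal (1 / 4) +
        ENNReal.ofReal C * ENNReal.ofReal (1 / (4 * (C + 1))) := by
        gcongr
        exact (setLIntegral_le_lintegral _ _).trans hx1.le
    _ ≤ ENNReal.ofReal (1 / 2) := by
        rw [← ENNReal.ofReal_mul hC, ← ENNReal.ofReal_add (by norm_num) (by positivity)]
        refine ENNReal.ofReal_le_ofReal ?_
        have : C * (1 / (4 * (C + 1))) ≤ 1 / 4 := by
          rw [mul_one_div, div_le_iff₀ (by positivity)]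
          linarith
        linarith

/-- Under the suitable `Δ₂`-condition, dilations of a function with small modular have small
modular. -/
theorem SuitableDelta2.exists_modular_smul_le_one [SigmaFinite μ] (hμ : HasUnitPointAtoms μ)
    (ha : Φ.a = 0) (h : SuitableDelta2 Φ μ) (n : ℕ) :
    ∃ c > 0, ∀ x : Ω →ₘ[μ] ℝ, modular Φ x < ENNReal.ofReal c →
      modular Φ ((2 : ℝ) ^ n • x) ≤ 1 := by
  have habs : ∀ {u m C : ℝ}, Φ (2 ^ n * |u|) ≤ m + C * Φ |u| →
      Φ (2 ^ n * u) ≤ m + C * Φ u := fun {u m C} h => by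
    rw [Φ.abs_apply] at h
    rwa [← Φ.abs_apply, abs_mul, abs_of_pos (by positivity : (0 : ℝ) < 2 ^ n)]
  have hA := measurableSet_atomicPart μ
  have small : ∀ M : ℝ, 0 ≤ M → ∃ u > 0, Φ (2 ^ n * u) * M ≤ 1 / 4 := fun M hM => by
    obtain ⟨v, hv, hΦ⟩ := Φ.exists_apply_le (e := 1 / (4 * (M + 1))) (by positivity)
    refine ⟨v / 2 ^ n, by positivity, ?_⟩
    rw [mul_div_cancel₀ _ (by positivity)]
    refine (mul_le_mul_of_nonneg_right hΦ hM).trans ?_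
    rw [one_div_mul_eq_div, div_le_iff₀ (by positivity)]
    linarith
  have toENN : ∀ {m : ℝ} {S : Set Ω}, 0 ≤ m → μ S < ∞ → m * (μ S).toReal ≤ 1 / 4 →
      ENNReal.ofReal m * μ S ≤ ENNReal.ofReal (1 / 4) := fun {m S} hm hS h => by
    rw [← ENNReal.ofReal_toReal hS.ne, ← ENNReal.ofReal_mul hm]
    exact ENNReal.ofReal_le_ofReal h
  have hna : ∃ c > 0, ∀ x : Ω →ₘ[μ] ℝ, modular Φ x < ENNReal.ofReal c →
      ∫⁻ t in (atomicPart μ)ᶜ, ENNReal.ofReal (Φ (2 ^ n * x t)) ∂μ ≤ ENNReal.ofReal (1 / 2) := by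
    rcases eq_or_ne (μ (atomicPart μ)ᶜ) 0 with h0 | h0
    · refine ⟨1, one_pos, fun x _ => ?_⟩
      rw [Measure.restrict_eq_zero.2 h0, lintegral_zero_measure]
      exact zero_le
    rcases eq_or_ne (μ (atomicPart μ)ᶜ) ∞ with h1 | h1
    · obtain ⟨C, hC, hΦ⟩ := (h.1 h1).iterate n
      refine setLIntegral_le_of_pointwise hA.compl le_rfl hC one_pos (by simp)
        fun x _ t _ => habs ?_
      rw [zero_add]
      exact hΦ _ (abs_nonneg _)
    -- Values below `u` contribute at most `1/4` on a set of finite measure; values above it are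
    -- controlled by `Δ₂(∞)`, whose threshold may be lowered to `u`.
    · obtain ⟨u, hu, hm⟩ := small (μ (atomicPart μ)ᶜ).toReal ENNReal.toReal_nonneg
      obtain ⟨C, hC, hΦ⟩ := (h.2.1 h0.bot_lt h1.lt_top).iterate ha n hu
      refine setLIntegral_le_of_pointwise hA.compl (Φ.nonneg (2 ^ n * u)) hC one_pos
        (toENN (Φ.nonneg _) h1.lt_top hm) fun x _ t _ => habs ?_
      have hn := mul_nonneg hC (Φ.nonneg |x t|)
      rcases le_total u |x t| with hux | hux
      · linarith [hΦ _ hux, Φ.nonneg (2 ^ n * u)]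
      · have := Φ.mono (u := 2 ^ n * |x t|) (v := 2 ^ n * u) (by positivity) (by gcongr)
        linarith
  have hat : ∃ c > 0, ∀ x : Ω →ₘ[μ] ℝ, modular Φ x < ENNReal.ofReal c →
      ∫⁻ t in atomicPart μ, ENNReal.ofReal (Φ (2 ^ n * x t)) ∂μ ≤ ENNReal.ofReal (1 / 2) := by
    have hlt : ∀ {u : ℝ}, 0 < u → ∀ x : Ω →ₘ[μ] ℝ, modular Φ x < ENNReal.ofReal (Φ u) →
        ∀ t ∈ atomicPart μ, |x t| ≤ u := fun {u} hu x hx t ht => by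
      by_contra! hux
      have h1 := apply_lt_of_modular_lt hμ hx ht
      rw [← Φ.abs_apply] at h1
      exact h1.not_ge (Φ.mono hu.le hux.le)
    rcases (atomicPart μ).finite_or_infinite with hf | hf
    -- Finitely many atoms need no growth condition: a modular below `Φ(u)` bounds `|x|` by `u` on
    -- every atom.
    · have hfin : μ (atomicPart μ) < ∞ := by
        rw [← biUnion_of_singleton (atomicPart μ)]
        refine measure_biUnion_lt_top hf fun ω hω => ?_
        rw [hμ.measure_singleton hω]
        exact ENNReal.one_lt_top
      obtain ⟨u, hu, hm⟩ := small (μ (atomicPart μ)).toReal ENNReal.toReal_nonneg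
      refine setLIntegral_le_of_pointwise hA (Φ.nonneg (2 ^ n * u)) le_rfl
        (Φ.pos_of_a_eq_zero ha hu) (toENN (Φ.nonneg _) hfin hm) fun x hx t ht => habs ?_
      rw [zero_mul, add_zero]
      exact Φ.mono (by positivity) (mul_le_mul_of_nonneg_left (hlt hu x hx t ht) (by positivity))
    · obtain ⟨u, hu, C, hC, hΦ⟩ := (h.2.2 hf).iterate n
      refine setLIntegral_le_of_pointwise hA le_rfl hC (Φ.pos_of_a_eq_zero ha hu) (by simp)
        fun x hx t ht => habs ?_
      rw [zero_add]
      exact hΦ _ (abs_nonneg _) (hlt hu x hx t ht)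
  obtain ⟨c₁, hc₁, h₁⟩ := hna
  obtain ⟨c₂, hc₂, h₂⟩ := hat
  refine ⟨min c₁ c₂, lt_min hc₁ hc₂, fun x hx => ?_⟩
  rw [modular_smul, ← lintegral_add_compl _ hA]
  refine (add_le_add
    (h₂ x (hx.trans_le (ENNReal.ofReal_le_ofReal (min_le_right _ _))))
    (h₁ x (hx.trans_le (ENNReal.ofReal_le_ofReal (min_le_left _ _))))).trans ?_
  rw [← ENNReal.ofReal_add (by norm_num) (by norm_num), ENNReal.ofReal_le_one]
  norm_num

variable {p : Seminorm ℝ (ℝ × ℝ)}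

/-- Under the suitable `Δ₂`-condition the modular of half a function is bounded below in terms of
the norm. -/
theorem SuitableDelta2.exists_le_modular [SigmaFinite μ] (hμ : HasUnitPointAtoms μ)
    (hp10 : p (1, 0) = 1) (hp01 : p (0, 1) = 1) (ha : Φ.a = 0) (h : SuitableDelta2 Φ μ)
    {ε : ℝ} (hε : 0 < ε) :
    ∃ c > 0, ∀ x : Ω →ₘ[μ] ℝ, ε ≤ pNorm Φ p x →
      ENNReal.ofReal c ≤ modular Φ ((1 / 2 : ℝ) • x) := by
  -- If `I(2^n x) ≤ 1`, then testing at `k = 2^n` gives norm at most `2/2^n < ε`. The extra power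
  -- below absorbs the factor `1/2`.
  obtain ⟨n, hn⟩ := pow_unbounded_of_one_lt (2 / ε) (one_lt_two (α := ℝ))
  obtain ⟨c, hc, hc'⟩ := h.exists_modular_smul_le_one hμ ha (n + 1)
  refine ⟨c, hc, fun x hx => ?_⟩
  by_contra! hlt
  have h1 := hc' _ hlt
  rw [smul_smul, show (2 : ℝ) ^ (n + 1) * (1 / 2) = 2 ^ n by ring] at h1
  have h2 := pNorm_le (p := p) (by positivity) (h1.trans_lt ENNReal.one_lt_top)
  have h3 := apply_le_abs_add_abs hp10 hp01 1 (modular Φ ((2 : ℝ) ^ n • x)).toReal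
  rw [abs_one, abs_of_nonneg ENNReal.toReal_nonneg] at h3
  have h4 : (modular Φ ((2 : ℝ) ^ n • x)).toReal ≤ 1 := ENNReal.toReal_le_of_le_ofReal zero_le_one
    (by rwa [ENNReal.ofReal_one])
  rw [one_div_mul_eq_div, le_div_iff₀ (by positivity)] at h2
  rw [div_lt_iff₀ hε] at hn
  nlinarith [pow_pos (two_pos (α := ℝ)) n]

/-- The difference is continuous and positive on the compact rectangle `[0,2] × [c,2]`, so it has a
positive lower bound there. -/
theorem exists_latticeNorm_sub_le (hmono : StrictlyMonotone (fun w : ℝ × ℝ => p w))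
    (hp10 : p (1, 0) = 1) (hp01 : p (0, 1) = 1) {c : ℝ} (hc : 0 < c) :
    ∃ δ > 0, ∀ t s : ℝ, 0 ≤ t → t ≤ 2 → c ≤ s → s ≤ 2 → p (t, s - c) ≤ p (t, s) - δ := by
  have hcont := continuous_latticeNorm hp10 hp01
  have hf : Continuous fun w : ℝ × ℝ => p w - p (w.1, w.2 - c) :=
    hcont.sub (hcont.comp (by fun_prop : Continuous fun w : ℝ × ℝ => (w.1, w.2 - c)))
  obtain ⟨δ, hδ, h⟩ := (isCompact_Icc (a := (0, c)) (b := ((2 : ℝ), (2 : ℝ)))).exists_forall_le'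
    hf.continuousOn (a := 0) fun w hw => by
      refine sub_pos.2 (hmono _ _ ?_ ?_ ?_)
      · exact ⟨hw.1.1, sub_nonneg.2 hw.1.2⟩
      · exact ⟨le_rfl, sub_le_self _ hc.le⟩
      · intro e
        have := congrArg Prod.snd e
        simp only at this
        linarith
  refine ⟨δ, hδ, fun t s h0 h1 h2 h3 => ?_⟩
  have := h (t, s) ⟨⟨h0, h2⟩, ⟨h1, h3⟩⟩
  simp only at this
  linarith

theorem SuitableDelta2.uniformlyMonotone [SigmaFinite μ] (hμ : HasUnitPointAtoms μ)
    (hp : IsLatticeNorm p) (hmono : StrictlyMonotone (fun w : ℝ × ℝ => p w))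
    (hp10 : p (1, 0) = 1) (hp01 : p (0, 1) = 1) (ha : Φ.a = 0) (h : SuitableDelta2 Φ μ) :
    UniformlyMonotone (normL μ Φ p) := by
  rintro ε ⟨hε, _⟩
  obtain ⟨c, hc, hcx⟩ := h.exists_le_modular hμ hp10 hp01 ha hε
  obtain ⟨δ, hδ, hδp⟩ := exists_latticeNorm_sub_le hmono hp10 hp01 hc
  -- With `η ≤ 1/2` the point `(1/k, I(ky)/k)` lies in `[0,2]²` and `2k ≥ 1`; with `2η ≤ δ`, `1 + η
  -- - δ ≤ 1 - η`.
  have hδ' : 0 < min (δ / 2) (1 / 2) := by positivity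
  have hle1 := min_le_left (δ / 2) (1 / 2)
  have hle2 := min_le_right (δ / 2) (1 / 2)
  refine ⟨min (δ / 2) (1 / 2), ⟨hδ', by linarith⟩, ?_⟩
  rintro ⟨x, hx⟩ ⟨y, hy⟩ h0 hxy hεx hy1
  change (0 : Ω →ₘ[μ] ℝ) ≤ x at h0
  change x ≤ y at hxy
  change ε ≤ pNorm Φ p x at hεx
  change pNorm Φ p y = 1 at hy1
  change pNorm Φ p (y - x) ≤ _
  generalize min (δ / 2) (1 / 2) = η at *
  obtain ⟨k, hk, hky, hlt⟩ := exists_lt_of_pNorm_lt hy (r := 1 + η) (by linarith)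
  have hkxy : k • x ≤ k • y := smul_le_smul_ae hk.le hxy
  have hkx0 : 0 ≤ k • x := by simpa using smul_le_smul_ae hk.le h0
  have hsub := modular_sub_add_le (Φ := Φ) hkx0 hkxy
  rw [← smul_sub] at hsub
  have hkxfin : modular Φ (k • x) < ∞ := (modular_mono hkx0 hkxy).trans_lt hky
  have hkdfin : modular Φ (k • (y - x)) < ∞ := (le_self_add.trans hsub).trans_lt hky
  have hsub' : (modular Φ (k • (y - x))).toReal + (modular Φ (k • x)).toReal ≤
      (modular Φ (k • y)).toReal := by
    rw [← ENNReal.toReal_add hkdfin.ne hkxfin.ne]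
    exact ENNReal.toReal_mono hky.ne hsub
  have hnorm := pNorm_le (p := p) hk hkdfin
  have hk0 : 0 ≤ 1 / k := by positivity
  rw [mul_latticeNorm hk0, mul_one] at hnorm hlt
  have ht : 1 / k ≤ 1 + η := by
    refine le_trans ?_ hlt.le
    have := one_le_latticeNorm hp hp10 (modular Φ (k • y)).toReal
    rw [← mul_one (1 / k), mul_assoc, ← mul_latticeNorm hk0, one_mul]
    nlinarith
  have hs : 1 / k * (modular Φ (k • y)).toReal ≤ 1 + η :=
    (le_latticeNorm hp hp01 _ _).trans hlt.le
  have hk2 : 1 ≤ 2 * k := by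
    rw [div_le_iff₀ hk] at ht
    nlinarith
  have hr : c ≤ 1 / k * (modular Φ (k • x)).toReal := by
    have h1 := mul_modular_le (Φ := Φ) hk2 ((1 / 2 : ℝ) • x)
    rw [smul_smul, show 2 * k * (1 / 2) = k by ring] at h1
    have h2 := (mul_le_mul_right (hcx x hεx) _).trans h1
    rw [← ENNReal.ofReal_mul (by positivity), ENNReal.ofReal_le_iff_le_toReal hkxfin.ne] at h2
    rw [one_div_mul_eq_div, le_div_iff₀ hk]
    nlinarith
  have hd0 : 0 ≤ (modular Φ (k • (y - x))).toReal := ENNReal.toReal_nonneg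
  have hsc : 1 / k * (modular Φ (k • (y - x))).toReal ≤
      1 / k * (modular Φ (k • y)).toReal - c := by
    have := mul_le_mul_of_nonneg_left hsub' hk0
    linarith
  have hd1 := mul_nonneg hk0 hd0
  have h1 : p (1 / k, 1 / k * (modular Φ (k • (y - x))).toReal) ≤
      p (1 / k, 1 / k * (modular Φ (k • y)).toReal - c) :=
    hp.mono _ _ _ _ le_rfl (by rwa [abs_of_nonneg hd1, abs_of_nonneg (hd1.trans hsc)])
  have h2 := hδp (1 / k) (1 / k * (modular Φ (k • y)).toReal) hk0 (by linarith)
    (by linarith) (by linarith)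
  linarith

end Smallness

/-! ### Sets of prescribed measure, up to a factor, in a nonatomic set. -/

section Nonatomic

variable {Ω : Type*} [MeasurableSpace Ω] {μ : Measure Ω}

/-- Every measurable subset of `S` of positive measure splits into two parts of positive
measure. -/
def NonatomicOn (μ : Measure Ω) (S : Set Ω) : Prop :=
  ∀ E ⊆ S, MeasurableSet E → 0 < μ E → ∃ B ⊆ E, MeasurableSet B ∧ 0 < μ B ∧ 0 < μ (E \ B)

theorem NonatomicOn.mono {S T : Set Ω} (h : NonatomicOn μ T) (hST : S ⊆ T) : NonatomicOn μ S :=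
  fun E hE => h E (hE.trans hST)

theorem HasUnitPointAtoms.nonatomicOn (hμ : HasUnitPointAtoms μ) :
    NonatomicOn μ (atomicPart μ)ᶜ := by
  intro E hE hEm hpos
  by_contra! h
  obtain ⟨ω, hω, h1, h2⟩ := hμ E ⟨hEm, hpos, fun B hB hBE => by
    rcases eq_or_ne (μ B) 0 with h0 | h0
    · exact Or.inl h0
    · exact Or.inr (nonpos_iff_eq_zero.1 (h B hBE hB h0.bot_lt))⟩
  exact hE hω ⟨h1, by rw [h2]; exact one_pos⟩

/-- Split repeatedly and keep the smaller part each time. -/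
theorem NonatomicOn.exists_subset_measure_le_div {S : Set Ω} (h : NonatomicOn μ S)
    (hS : MeasurableSet S) (h0 : 0 < μ S) (n : ℕ) :
    ∃ B ⊆ S, MeasurableSet B ∧ 0 < μ B ∧ 2 ^ n * μ B ≤ μ S := by
  induction n with
  | zero => exact ⟨S, Subset.rfl, hS, h0, by simp⟩
  | succ n ih =>
    obtain ⟨B, hBS, hB, hB0, hle⟩ := ih
    obtain ⟨C, hCB, hC, hC0, hC1⟩ := h B hBS hB hB0
    have hsum : μ C + μ (B \ C) = μ B := by
      rw [← measure_inter_add_sdiff B hC, inter_eq_self_of_subset_right hCB]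
    have key : ∀ D, 2 * μ D ≤ μ B → (2 : ℝ≥0∞) ^ (n + 1) * μ D ≤ μ S := fun D hD => by
      rw [pow_succ, mul_assoc]
      exact (mul_le_mul_right hD _).trans hle
    rcases le_total (μ C) (μ (B \ C)) with hle' | hle'
    · refine ⟨C, hCB.trans hBS, hC, hC0, key _ ?_⟩
      rw [two_mul, ← hsum]
      gcongr
    · refine ⟨B \ C, sdiff_subset.trans hBS, hB.diff hC, hC1, key _ ?_⟩
      rw [two_mul, ← hsum]
      gcongr

theorem NonatomicOn.exists_subset_measure_le [SigmaFinite μ] {S : Set Ω} (h : NonatomicOn μ S)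
    (hS : MeasurableSet S) (h0 : 0 < μ S) {e : ℝ≥0∞} (he : e ≠ 0) :
    ∃ B ⊆ S, MeasurableSet B ∧ 0 < μ B ∧ μ B ≤ e := by
  obtain ⟨T, hT, hTS, hT0, hTfin⟩ := Measure.exists_subset_measure_lt_top hS h0
  obtain ⟨n, hn⟩ := ENNReal.exists_nat_mul_gt he hTfin.ne
  obtain ⟨B, hBT, hB, hB0, hle⟩ := (h.mono hTS).exists_subset_measure_le_div hT hT0 n
  refine ⟨B, hBT.trans hTS, hB, hB0, ?_⟩
  by_contra! hlt
  refine (hle.trans_lt hn).not_ge ?_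
  have : (n : ℝ≥0∞) ≤ 2 ^ n := by exact_mod_cast n.lt_two_pow_self.le
  exact mul_le_mul' this hlt.le

/-- On a nonatomic set, every admissible measure is attained up to a factor of two. -/
theorem NonatomicOn.exists_subset_measure_mem_Icc [SigmaFinite μ] {S : Set Ω}
    (h : NonatomicOn μ S) (hS : MeasurableSet S) {α : ℝ≥0∞} (h0 : α ≠ 0) (htop : α ≠ ∞)
    (hα : α ≤ μ S) : ∃ B ⊆ S, MeasurableSet B ∧ α / 2 ≤ μ B ∧ μ B ≤ α := by
  by_contra! hcon
  -- If no measure lies in `[α/2, α]`, sets of measure at most `α` have measure below `α/2`. They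
  -- are therefore closed under finite unions, and the union of a maximizing sequence attains the
  -- supremum of their measures.
  have hlt : ∀ B ⊆ S, MeasurableSet B → μ B ≤ α → μ B < α / 2 := fun B hB hBm hle => by
    by_contra! h'
    exact (hcon B hB hBm h').not_ge hle
  let V : Set ℝ≥0∞ := {v | ∃ B ⊆ S, MeasurableSet B ∧ μ B ≤ α ∧ μ B = v}
  obtain ⟨v, -, hv, hvV⟩ := exists_seq_tendsto_sSup (S := V)
    ⟨0, ∅, empty_subset _, MeasurableSet.empty, by simp, by simp⟩ (OrderTop.bddAbove V)
  choose B hBS hBm hBα hBv using hvV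
  have hacc : ∀ n, accumulate B n ⊆ S ∧ MeasurableSet (accumulate B n) ∧
      μ (accumulate B n) ≤ α := fun n => by
    induction n with
    | zero => simpa [accumulate_zero_nat] using ⟨hBS 0, hBm 0, hBα 0⟩
    | succ n ih =>
      rw [accumulate_succ]
      refine ⟨union_subset ih.1 (hBS _), ih.2.1.union (hBm _), ?_⟩
      refine (measure_union_le _ _).trans ?_
      rw [← ENNReal.add_halves α]
      exact add_le_add (hlt _ ih.1 ih.2.1 ih.2.2).le (hlt _ (hBS _) (hBm _) (hBα _)).le
  have hUS : ⋃ n, B n ⊆ S := iUnion_subset hBS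
  have hUm : MeasurableSet (⋃ n, B n) := MeasurableSet.iUnion hBm
  have hUα : μ (⋃ n, B n) ≤ α := by
    rw [measure_iUnion_eq_iSup_accumulate]
    exact iSup_le fun n => (hacc n).2.2
  have hsup : sSup V ≤ μ (⋃ n, B n) := le_of_tendsto' hv fun n => by
    rw [← hBv n]
    exact measure_mono (subset_iUnion B n)
  have hUlt := hlt _ hUS hUm hUα
  have hhalf : α / 2 ≠ 0 := by simpa using h0
  have hUtop : μ (⋃ n, B n) ≠ ∞ := (hUα.trans_lt htop.lt_top).ne
  have hdiff : 0 < μ (S \ ⋃ n, B n) := by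
    refine lt_of_lt_of_le ?_ le_measure_sdiff
    exact tsub_pos_of_lt ((hUlt.trans_le ENNReal.half_le_self).trans_le hα)
  -- Adjoining a small set `D` of positive measure keeps the total at most `α` but exceeds the
  -- supremum.
  obtain ⟨D, hD, hDm, hD0, hDα⟩ := (h.mono sdiff_subset).exists_subset_measure_le
    (hS.diff hUm) hdiff hhalf
  have hdisj : Disjoint (⋃ n, B n) D := (disjoint_sdiff_left.mono_left hD).symm
  have hsum : μ ((⋃ n, B n) ∪ D) = μ (⋃ n, B n) + μ D := measure_union hdisj hDm
  have hmem : μ (⋃ n, B n) + μ D ∈ V := by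
    refine ⟨(⋃ n, B n) ∪ D, union_subset hUS (hD.trans sdiff_subset), hUm.union hDm, ?_, hsum⟩
    rw [hsum, ← ENNReal.add_halves α]
    exact add_le_add hUlt.le hDα
  exact ((le_sSup hmem).trans hsup).not_gt (ENNReal.lt_add_right hUtop hD0.ne')

end Nonatomic

/-! ### Step functions. -/

section StepFunctions

variable {Ω : Type*} [MeasurableSpace Ω] {μ : Measure Ω} {Φ : OrliczFunction}
  {p : Seminorm ℝ (ℝ × ℝ)}

/-- The class of the function equal to `u` on `B` and to zero elsewhere. -/
noncomputable def constOn (μ : Measure Ω) {B : Set Ω} (hB : MeasurableSet B) (u : ℝ) : Ω →ₘ[μ] ℝ :=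
  AEEqFun.mk (B.indicator fun _ => u) (measurable_const.indicator hB).aestronglyMeasurable

theorem coeFn_constOn {B : Set Ω} (hB : MeasurableSet B) (u : ℝ) :
    constOn μ hB u =ᵐ[μ] B.indicator fun _ => u :=
  AEEqFun.coeFn_mk _ _

theorem modular_smul_constOn {B : Set Ω} (hB : MeasurableSet B) (c u : ℝ) :
    modular Φ (c • constOn μ hB u) = ENNReal.ofReal (Φ (c * u)) * μ B := by
  rw [modular_smul, ← lintegral_indicator_const hB]
  refine lintegral_congr_ae ?_
  filter_upwards [coeFn_constOn (μ := μ) hB u] with t h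
  rw [h]
  by_cases ht : t ∈ B <;> simp [ht, Φ.map_zero]

theorem constOn_nonneg {B : Set Ω} (hB : MeasurableSet B) {u : ℝ} (hu : 0 ≤ u) :
    0 ≤ constOn μ hB u := by
  rw [← AEEqFun.coeFn_le]
  filter_upwards [coeFn_constOn (μ := μ) hB u, AEEqFun.coeFn_zero (α := Ω) (β := ℝ) (μ := μ)]
    with t h1 h2
  rw [h1, h2]
  exact indicator_nonneg (fun _ _ => hu) t

theorem constOn_mem_orliczHeart {B : Set Ω} (hB : MeasurableSet B) (hfin : μ B < ∞) (u : ℝ) :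
    constOn μ hB u ∈ orliczHeart μ Φ := fun l _ => by
  rw [modular_smul_constOn]
  exact ENNReal.mul_lt_top ENNReal.ofReal_lt_top hfin

theorem modular_smul_constOn_add {A B : Set Ω} (hA : MeasurableSet A) (hB : MeasurableSet B)
    (hAB : Disjoint A B) (c v d u : ℝ) :
    modular Φ (c • constOn μ hA v + d • constOn μ hB u) =
      modular Φ (c • constOn μ hA v) + modular Φ (d • constOn μ hB u) := by
  rw [modular_smul, modular_smul, modular, ← lintegral_add_left']
  · refine lintegral_congr_ae ?_
    filter_upwards [coeFn_constOn (μ := μ) hA v, coeFn_constOn (μ := μ) hB u,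
      AEEqFun.coeFn_add (c • constOn μ hA v) (d • constOn μ hB u),
      AEEqFun.coeFn_smul c (constOn μ hA v), AEEqFun.coeFn_smul d (constOn μ hB u)]
      with t h1 h2 h3 h4 h5
    rw [h3, Pi.add_apply, h4, h5, Pi.smul_apply, Pi.smul_apply, h1, h2, smul_eq_mul, smul_eq_mul]
    by_cases htA : t ∈ A
    · have htB : t ∉ B := hAB.notMem_of_mem_left htA
      simp [htA, htB, Φ.map_zero]
    · simp [htA, Φ.map_zero]
  · exact (Φ.continuous.measurable.comp_aemeasurable
      ((constOn μ hA v).aemeasurable.const_mul c)).ennreal_ofReal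

theorem pNorm_constOn_pos (hp : IsLatticeNorm p) (hp10 : p (1, 0) = 1) (hp01 : p (0, 1) = 1)
    {B : Set Ω} (hB : MeasurableSet B) (h0 : 0 < μ B) (hfin : μ B < ∞) {u : ℝ} (hu : 0 < u) :
    0 < pNorm Φ p (constOn μ hB u) := by
  obtain ⟨v, hv, hΦ⟩ := Φ.exists_le_apply (1 / (μ B).toReal)
  have hB0 : 0 < (μ B).toReal := ENNReal.toReal_pos h0.ne' hfin.ne
  have hmem := orliczHeart_le_orliczSpace (constOn_mem_orliczHeart (Φ := Φ) hB hfin u)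
  have hmod : ENNReal.ofReal 1 ≤ modular Φ ((v / u) • constOn μ hB u) := by
    rw [modular_smul_constOn, div_mul_cancel₀ _ hu.ne', ← ENNReal.ofReal_toReal hfin.ne,
      ← ENNReal.ofReal_mul (Φ.nonneg v)]
    exact ENNReal.ofReal_le_ofReal ((div_le_iff₀ hB0).1 hΦ)
  have h1 := le_pNorm_of_le_modular hp hp10 hp01 ((orliczSpace μ Φ).smul_mem _ hmem)
    zero_le_one le_rfl hmod
  rw [pNorm_smul hmem (by positivity)] at h1
  exact pos_of_mul_pos_right (one_pos.trans_le h1) (by positivity)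

end StepFunctions

/-! ### From monotonicity of `E^Φ` back to the `Δ₂`-condition. -/

section Necessity

variable {Ω : Type*} [MeasurableSpace Ω] {μ : Measure Ω} {Φ : OrliczFunction}
  {p : Seminorm ℝ (ℝ × ℝ)}

/-- If `E^Φ` is upper locally uniformly monotone and the infimum in the norm is attained, then step
functions of norm bounded below, supported off a fixed set, have modulars bounded below. -/
theorem UpperLocallyUniformlyMonotone.exists_le_modular_constOn (hp : IsLatticeNorm p)
    (hp10 : p (1, 0) = 1) (hp01 : p (0, 1) = 1)
    (h : UpperLocallyUniformlyMonotone (OrliczLattice.normE μ Φ p))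
    (hK : ∀ x : orliczHeart μ Φ, x ≠ 0 → (minimizers Φ p (x : Ω →ₘ[μ] ℝ)).Nonempty)
    {A : Set Ω} (hA : MeasurableSet A) (hA0 : 0 < μ A) (hAfin : μ A < ∞) {ε : ℝ} (hε : 0 < ε) :
    ∃ η > 0, ∀ (B : Set Ω) (hB : MeasurableSet B), Disjoint A B → μ B < ∞ → ∀ u : ℝ, 0 ≤ u →
      ε ≤ pNorm Φ p (constOn μ hB u) → η ≤ Φ u * (μ B).toReal := by
  have hmem := constOn_mem_orliczHeart (Φ := Φ) hA hAfin 1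
  have hmemL := orliczHeart_le_orliczSpace hmem
  have hpos := pNorm_constOn_pos (Φ := Φ) hp hp10 hp01 hA hA0 hAfin one_pos
  have hinv := inv_pos.2 hpos
  set c := (pNorm Φ p (constOn μ hA 1))⁻¹ with hc
  have hnorm : pNorm Φ p (c • constOn μ hA 1) = 1 := by
    rw [pNorm_smul hmemL hinv, hc, inv_mul_cancel₀ hpos.ne']
  let y : orliczHeart μ Φ := c • ⟨constOn μ hA 1, hmem⟩
  have hyc : (y : Ω →ₘ[μ] ℝ) = c • constOn μ hA 1 := rfl
  have hy0 : (0 : Ω →ₘ[μ] ℝ) ≤ y := by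
    rw [hyc]
    simpa using smul_le_smul_ae hinv.le (constOn_nonneg (μ := μ) hA zero_le_one)
  -- Homogeneity gives `‖0‖ = 2‖0‖`, which is incompatible with `‖y‖ = 1`.
  have hne : y ≠ 0 := fun e => by
    have e' : c • constOn μ hA 1 = 0 := by rw [← hyc, e]; rfl
    rw [e'] at hnorm
    have h2 := pNorm_smul (Φ := Φ) (p := p) (orliczSpace μ Φ).zero_mem (two_pos (α := ℝ))
    rw [smul_zero, hnorm] at h2
    norm_num at h2
  obtain ⟨k, hk, hky, hmin⟩ := hK y hne
  rw [hyc] at hky hmin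
  rw [hnorm] at hmin
  obtain ⟨σ, hσ, hσx⟩ := h y hy0 (by rw [OrliczLattice.normE, hyc, hnorm]) (ε / k) (by positivity)
  refine ⟨σ * k, by positivity, fun B hB hAB hBfin u hu hεu => ?_⟩
  have hBmem := constOn_mem_orliczHeart (Φ := Φ) hB hBfin u
  have hx := hσx (k⁻¹ • ⟨constOn μ hB u, hBmem⟩)
    (show (0 : Ω →ₘ[μ] ℝ) ≤ k⁻¹ • constOn μ hB u by
      simpa using smul_le_smul_ae (inv_nonneg.2 hk.le) (constOn_nonneg (μ := μ) hB hu)) (by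
      change ε / k ≤ pNorm Φ p (k⁻¹ • constOn μ hB u)
      rw [pNorm_smul (orliczHeart_le_orliczSpace hBmem) (inv_pos.2 hk), div_eq_inv_mul]
      exact mul_le_mul_of_nonneg_left hεu (inv_nonneg.2 hk.le))
  change 1 + σ ≤ pNorm Φ p (c • constOn μ hA 1 + k⁻¹ • constOn μ hB u) at hx
  have hB1 : modular Φ ((1 : ℝ) • constOn μ hB u) = ENNReal.ofReal (Φ u) * μ B := by
    rw [modular_smul_constOn, one_mul]
  have hBlt : ENNReal.ofReal (Φ u) * μ B < ∞ := ENNReal.mul_lt_top ENNReal.ofReal_lt_top hBfin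
  have hmod : modular Φ (k • (c • constOn μ hA 1 + k⁻¹ • constOn μ hB u)) =
      modular Φ (k • c • constOn μ hA 1) + ENNReal.ofReal (Φ u) * μ B := by
    rw [smul_add, smul_smul, smul_smul, mul_inv_cancel₀ hk.ne',
      modular_smul_constOn_add hA hB hAB, hB1]
  have hle := pNorm_le (p := p) hk (hmod ▸ ENNReal.add_lt_top.2 ⟨hky, hBlt⟩)
  rw [hmod, ENNReal.toReal_add hky.ne hBlt.ne, ENNReal.toReal_mul,
    ENNReal.toReal_ofReal (Φ.nonneg u)] at hle
  have hr : 0 ≤ Φ u * (μ B).toReal := mul_nonneg (Φ.nonneg u) ENNReal.toReal_nonneg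
  have hadd := mul_le_mul_of_nonneg_left
    (latticeNorm_add_le hp01 1 (modular Φ (k • c • constOn μ hA 1)).toReal hr)
    (by positivity : 0 ≤ 1 / k)
  rw [mul_add, ← hmin] at hadd
  have : σ ≤ 1 / k * (Φ u * (μ B).toReal) := by linarith
  rwa [one_div_mul_eq_div, le_div_iff₀ hk] at this

/-- The failure of a `Δ₂`-condition along a set of arguments for which suitable sets exist is
incompatible with upper local uniform monotonicity. -/
theorem UpperLocallyUniformlyMonotone.exists_delta2_const (hp : IsLatticeNorm p)
    (hp10 : p (1, 0) = 1) (hp01 : p (0, 1) = 1)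
    (h : UpperLocallyUniformlyMonotone (OrliczLattice.normE μ Φ p))
    (hK : ∀ x : orliczHeart μ Φ, x ≠ 0 → (minimizers Φ p (x : Ω →ₘ[μ] ℝ)).Nonempty)
    {A : Set Ω} (hA : MeasurableSet A) (hA0 : 0 < μ A) (hAfin : μ A < ∞) {J : Set ℝ}
    (hJ : ∀ u ∈ J, 0 ≤ u)
    (hS : ∀ u ∈ J, 0 < Φ (2 * u) → ∃ B, MeasurableSet B ∧ Disjoint A B ∧
      ENNReal.ofReal (1 / Φ (2 * u)) / 2 ≤ μ B ∧ μ B ≤ ENNReal.ofReal (1 / Φ (2 * u))) :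
    ∃ K > 0, ∀ u ∈ J, Φ (2 * u) ≤ K * Φ u := by
  -- Since `μ(B) ≥ 1/(2Φ(2u))`, the modular of `2u 1_B` is at least `1/2`, so `u 1_B` has norm at
  -- least `1/4`.
  obtain ⟨η, hη, hmod⟩ := h.exists_le_modular_constOn hp hp10 hp01 hK hA hA0 hAfin
    (ε := 1 / 4) (by norm_num)
  refine ⟨1 / η, by positivity, fun u hu => ?_⟩
  rcases (Φ.nonneg (2 * u)).eq_or_lt with h0 | h0
  · rw [← h0]
    exact mul_nonneg (by positivity) (Φ.nonneg u)
  obtain ⟨B, hB, hAB, hB1, hB2⟩ := hS u hu h0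
  have hBfin : μ B < ∞ := hB2.trans_lt ENNReal.ofReal_lt_top
  have hBle : (μ B).toReal ≤ 1 / Φ (2 * u) := ENNReal.toReal_le_of_le_ofReal (by positivity) hB2
  have hmem := orliczHeart_le_orliczSpace (constOn_mem_orliczHeart (Φ := Φ) hB hBfin u)
  have h2 : ENNReal.ofReal (1 / 2) ≤ modular Φ ((2 : ℝ) • constOn μ hB u) := by
    rw [modular_smul_constOn]
    refine le_trans (le_of_eq ?_) (mul_le_mul_right hB1 _)
    rw [← mul_div_assoc, ← ENNReal.ofReal_mul h0.le, mul_one_div_cancel h0.ne',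
      ENNReal.ofReal_div_of_pos two_pos, ENNReal.ofReal_ofNat]
  have h3 := le_pNorm_of_le_modular hp hp10 hp01 ((orliczSpace μ Φ).smul_mem _ hmem)
    (by norm_num) (by norm_num) h2
  rw [pNorm_smul hmem two_pos] at h3
  have h4 := hmod B hB hAB hBfin u (hJ u hu) (by linarith)
  have h5 := h4.trans (mul_le_mul_of_nonneg_left hBle (Φ.nonneg u))
  rw [mul_one_div, le_div_iff₀ h0] at h5
  rw [one_div_mul_eq_div, le_div_iff₀ hη]
  linarith

theorem UpperLocallyUniformlyMonotone.a_eq_zero [SigmaFinite μ] (hp : IsLatticeNorm p)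
    (hp10 : p (1, 0) = 1) (hp01 : p (0, 1) = 1)
    (h : UpperLocallyUniformlyMonotone (OrliczLattice.normE μ Φ p))
    (hK : ∀ x : orliczHeart μ Φ, x ≠ 0 → (minimizers Φ p (x : Ω →ₘ[μ] ℝ)).Nonempty)
    (hA : ∃ A : Set Ω, MeasurableSet A ∧ 0 < μ A ∧ 0 < μ Aᶜ) : Φ.a = 0 := by
  by_contra ha
  obtain ⟨u, hu, hΦ⟩ := Φ.exists_zero_of_a_ne_zero ha
  obtain ⟨A₀, hA₀, h1, h2⟩ := hA
  obtain ⟨A, hA, hAA, hA0, hAfin⟩ := Measure.exists_subset_measure_lt_top hA₀ h1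
  obtain ⟨B, hB, hBA, hB0, hBfin⟩ := Measure.exists_subset_measure_lt_top hA₀.compl h2
  obtain ⟨η, hη, hmod⟩ := h.exists_le_modular_constOn hp hp10 hp01 hK hA hA0 hAfin
    (pNorm_constOn_pos (Φ := Φ) hp hp10 hp01 hB hB0 hBfin hu)
  have := hmod B hB (disjoint_compl_right.mono hAA hBA) hBfin u hu.le le_rfl
  rw [hΦ, zero_mul] at this
  linarith

theorem exists_atoms_measure_mem_Icc [SigmaFinite μ] (hμ : HasUnitPointAtoms μ) {S : Set Ω}
    (hS : S ⊆ atomicPart μ) (hinf : S.Infinite) {α : ℝ} (hα : 1 ≤ α) :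
    ∃ B ⊆ S, MeasurableSet B ∧ ENNReal.ofReal α / 2 ≤ μ B ∧ μ B ≤ ENNReal.ofReal α := by
  obtain ⟨F, hF, hcard⟩ := hinf.exists_subset_card_eq ⌊α⌋₊
  have hmeas : μ (F : Set Ω) = (⌊α⌋₊ : ℝ≥0∞) := by
    rw [← hcard, ← biUnion_of_singleton (F : Set Ω)]
    rw [measure_biUnion F.countable_toSet (fun a _ b _ hab => by
      simpa [Function.onFun] using hab) (fun ω hω => (hS (hF hω)).1)]
    rw [tsum_congr fun ω : (F : Set Ω) => hμ.measure_singleton (hS (hF ω.2))]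
    simp
  refine ⟨F, hF, measurableSet_of_subset_atomicPart (hF.trans hS), ?_, ?_⟩
  · rw [hmeas, ← ENNReal.ofReal_natCast, ← ENNReal.ofReal_ofNat,
      ← ENNReal.ofReal_div_of_pos two_pos]
    refine ENNReal.ofReal_le_ofReal ?_
    -- As `⌊α⌋ ≥ 1`, `α < ⌊α⌋ + 1 ≤ 2⌊α⌋`.
    have h1 := Nat.lt_floor_add_one α
    have h2 : (1 : ℝ) ≤ ⌊α⌋₊ := by exact_mod_cast Nat.le_floor (by simpa using hα)
    linarith
  · rw [hmeas, ← ENNReal.ofReal_natCast]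
    exact ENNReal.ofReal_le_ofReal (Nat.floor_le (by linarith))

theorem UpperLocallyUniformlyMonotone.suitableDelta2 [SigmaFinite μ] (hμ : HasUnitPointAtoms μ)
    (hp : IsLatticeNorm p) (hp10 : p (1, 0) = 1) (hp01 : p (0, 1) = 1)
    (h : UpperLocallyUniformlyMonotone (OrliczLattice.normE μ Φ p))
    (hK : ∀ x : orliczHeart μ Φ, x ≠ 0 → (minimizers Φ p (x : Ω →ₘ[μ] ℝ)).Nonempty) :
    SuitableDelta2 Φ μ := by
  have hat := measurableSet_atomicPart μ
  have hna := hμ.nonatomicOn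
  refine ⟨fun htop => ?_, fun h0 hfin => ?_, fun hinf => ?_⟩
  · obtain ⟨A, hA, hAna, hA0, hAfin⟩ := Measure.exists_subset_measure_lt_top hat.compl
      (μ := μ) (r := 0) (by rw [htop]; exact ENNReal.zero_lt_top)
    obtain ⟨K, hK0, hKu⟩ := h.exists_delta2_const hp hp10 hp01 hK hA hA0 hAfin (J := Ici 0)
      (fun _ hu => hu) fun u _ hΦ => by
        have hdiff : μ ((atomicPart μ)ᶜ \ A) = ∞ := by
          rw [measure_sdiff_eq_top htop hAfin.ne]
        obtain ⟨B, hBS, hB, h1, h2⟩ := (hna.mono sdiff_subset).exists_subset_measure_mem_Icc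
          (hat.compl.diff hA) (α := ENNReal.ofReal (1 / Φ (2 * u)))
          (by simpa using hΦ) ENNReal.ofReal_ne_top (by rw [hdiff]; exact le_top)
        exact ⟨B, hB, (disjoint_sdiff_left.mono_left hBS).symm, h1, h2⟩
    exact ⟨K, hK0, hKu⟩
  · have hhalf : μ (atomicPart μ)ᶜ / 2 ≠ 0 := by simpa using h0.ne'
    obtain ⟨A, hAna, hA, hA1, hA2⟩ := hna.exists_subset_measure_mem_Icc hat.compl hhalf
      (ENNReal.half_lt_self h0.ne' hfin.ne |>.trans hfin).ne ENNReal.half_le_self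
    have hA0 : 0 < μ A := lt_of_lt_of_le (by simpa [pos_iff_ne_zero] using h0.ne') hA1
    have hAlt : μ A < μ (atomicPart μ)ᶜ := hA2.trans_lt (ENNReal.half_lt_self h0.ne' hfin.ne)
    have hdiff0 : 0 < μ ((atomicPart μ)ᶜ \ A) := by
      refine lt_of_lt_of_le ?_ le_measure_sdiff
      exact tsub_pos_of_lt hAlt
    have hdiffin : μ ((atomicPart μ)ᶜ \ A) < ∞ := (measure_mono sdiff_subset).trans_lt hfin
    have hd := ENNReal.toReal_pos hdiff0.ne' hdiffin.ne
    -- For `u ≥ v` the target measure `1/Φ(2u)` then fits into what remains after removing `A`.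
    obtain ⟨v, hv, hΦv⟩ := Φ.exists_le_apply (1 / (μ ((atomicPart μ)ᶜ \ A)).toReal)
    obtain ⟨K, hK0, hKu⟩ := h.exists_delta2_const hp hp10 hp01 hK hA hA0 (hAlt.trans hfin)
      (J := Ici v) (fun _ hu => hv.le.trans hu) fun u hu hΦ => by
        have hvu : v ≤ u := hu
        obtain ⟨B, hBS, hB, h1, h2⟩ := (hna.mono sdiff_subset).exists_subset_measure_mem_Icc
          (hat.compl.diff hA) (α := ENNReal.ofReal (1 / Φ (2 * u)))
          (by simpa using hΦ) ENNReal.ofReal_ne_top (by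
            refine ENNReal.ofReal_le_of_le_toReal ?_
            rw [one_div_le hΦ hd]
            exact hΦv.trans (Φ.mono hv.le (by linarith)))
        exact ⟨B, hB, (disjoint_sdiff_left.mono_left hBS).symm, h1, h2⟩
    exact ⟨v, hv, K, hK0, hKu⟩
  · obtain ⟨ω, hω⟩ := hinf.nonempty
    have hω1 := hμ.measure_singleton hω
    -- Restricting to `u ≤ v/2` makes `1/Φ(2u) ≥ 1`, so at least one unit atom fits.
    obtain ⟨v, hv, hΦv⟩ := Φ.exists_apply_le one_pos
    obtain ⟨K, hK0, hKu⟩ := h.exists_delta2_const hp hp10 hp01 hK hω.1 hω.2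
      (by rw [hω1]; exact ENNReal.one_lt_top) (J := Icc 0 (v / 2)) (fun _ hu => hu.1)
      fun u hu hΦ => by
        obtain ⟨B, hBS, hB, h1, h2⟩ := exists_atoms_measure_mem_Icc hμ
          (S := atomicPart μ \ {ω}) sdiff_subset (hinf.sdiff (finite_singleton ω))
          (α := 1 / Φ (2 * u)) (by
            rw [le_div_iff₀ hΦ, one_mul]
            exact (Φ.mono (by linarith [hu.1]) (by linarith [hu.2])).trans hΦv)
        exact ⟨B, hB, (disjoint_sdiff_left.mono_left hBS).symm, h1, h2⟩
    exact ⟨v / 2, by positivity, K, hK0, fun u h0 h1 => hKu u ⟨h0, h1⟩⟩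

end Necessity

end OrliczLattice

open OrliczLattice
theorem theorem9 {Ω : Type*} [MeasurableSpace Ω] (μ : Measure Ω) [SigmaFinite μ]
    (hμ : HasUnitPointAtoms μ)
    (p : Seminorm ℝ (ℝ × ℝ)) (hp : IsLatticeNorm p)
    (hmono : StrictlyMonotone (fun w : ℝ × ℝ => p w))
    (hp10 : p (1, 0) = 1) (hp01 : p (0, 1) = 1)
    (Φ : OrliczFunction) :
    ((Φ.a = 0 ∧ SuitableDelta2 Φ μ → UniformlyMonotone (normL μ Φ p)) ∧
      (UniformlyMonotone (normL μ Φ p) → UpperLocallyUniformlyMonotone (normL μ Φ p)) ∧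
      (UpperLocallyUniformlyMonotone (normL μ Φ p) →
        UpperLocallyUniformlyMonotone (normE μ Φ p))) ∧
    ((∃ A : Set Ω, MeasurableSet A ∧ 0 < μ A ∧ 0 < μ Aᶜ) →
      (∀ x : orliczHeart μ Φ, x ≠ 0 → (minimizers Φ p (x : Ω →ₘ[μ] ℝ)).Nonempty) →
      [Φ.a = 0 ∧ SuitableDelta2 Φ μ,
        UniformlyMonotone (normL μ Φ p),
        UpperLocallyUniformlyMonotone (normL μ Φ p),
        UpperLocallyUniformlyMonotone (normE μ Φ p)].TFAE) := by
  have h12 : Φ.a = 0 ∧ SuitableDelta2 Φ μ → UniformlyMonotone (normL μ Φ p) := fun h =>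
    h.2.uniformlyMonotone hμ hp hmono hp10 hp01 h.1
  have h23 : UniformlyMonotone (normL μ Φ p) → UpperLocallyUniformlyMonotone (normL μ Φ p) :=
    fun h => h.upperLocallyUniformlyMonotone_normL hp
  have h34 : UpperLocallyUniformlyMonotone (normL μ Φ p) →
      UpperLocallyUniformlyMonotone (normE μ Φ p) := fun h => h.normE
  refine ⟨⟨h12, h23, h34⟩, fun hA hK => ?_⟩
  have h41 : UpperLocallyUniformlyMonotone (normE μ Φ p) → Φ.a = 0 ∧ SuitableDelta2 Φ μ :=
    fun h => ⟨h.a_eq_zero hp hp10 hp01 hK hA, h.suitableDelta2 hμ hp hp10 hp01 hK⟩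
  tfae_have 1 → 2 := h12
  tfae_have 2 → 3 := h23
  tfae_have 3 → 4 := h34
  tfae_have 4 → 1 := h41
  tfae_finish
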